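/- Let $G=\prod_{j=0}^{\infty}\mathbb{Z}_2$ be the dyadic (Walsh) group with its normalized Haar measure $\mu$. Let $w_k(x)=\prod_j(-1)^{k_jx_j}$, for $k=\sum_j k_j2^j$ with $k_j\in\{0,1\}$, be the Walsh functions, and for $x\in G$ put $I_m(x)=\{y\in G: y_0=x_0,\dots,y_{m-1}=x_{m-1}\}$. For $0<p<1$ let $H_p(G)$ be the space of real-valued martingales $F=(F_m)_{m\ge 0}$ with respect to the dyadic filtration (the $m$-th $\sigma$-algebra is generated by the sets $I_m(x)$, $x\in G$) for which $\|F\|_{H_p}:=\big\|\sup_m|F_m|\big\|_p<\infty$. Put $\widehat F(k)=\lim_{m\to\infty}\int_G F_mw_k\,d\mu$ and $S_nF=\sum_{k=0}^{n-1}\widehat F(k)w_k$. For an integer $n=\sum_j n_j2^j\ge 1$ with $n_j\in\{0,1\}$ put $\rho(n)=\max\{j:n_j\neq0\}-\min\{j:n_j\ne0\}$. Finally let $\|f\|_p=\big(\int_G|f|^p\,d\mu\big)^{1/p}$ and $\|f\|_{\text{weak-}L_p}=\big(\sup_{t>0}t^p\mu(|f|>t)\big)^{1/p}$. Let $0<p<1$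 and let $(n_k)_{k\ge 0}$ be an increasing (not necessarily strictly) sequence of positive integers. Then the maximal operator $F\mapsto\sup_k|S_{n_k}F|$ is bounded from $H_p(G)$ to $\text{weak-}L_p(G)$, that is, there is a finite constant $C$ with $\big\|\sup_k|S_{n_k}F|\big\|_{\text{weak-}L_p}\le C\|F\|_{H_p}$ for all $F\in H_p(G)$, if and only if $\sup_k\rho(n_k)<\infty$. Likewise, it is bounded from $H_p(G)$ to $L_p(G)$, that is, there is a finite constant $C$ with $\big\|\sup_k|S_{n_k}F|\big\|_p\le C\|F\|_{H_p}$ for all $F\in H_p(G)$, if and only if $\sup_k\rho(n_k)<\infty$. -/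

import Mathlib

open MeasureTheory ProbabilityTheory Filter Topology
open scoped NNReal ENNReal

/-- The group `G`, the complete direct product of countably many copies of `Z₂ = {0, 1}`. -/
abbrev WalshGroup : Type := ℕ → ZMod 2

namespace WalshGroup

/-- The normalized Haar measure of `G`: the product of the measures on `Z₂` that give each
singleton the mass `1/2`. -/
noncomputable def haar : Measure WalshGroup :=
  Measure.infinitePi (fun _ : ℕ => (uniformOn Set.univ : Measure (ZMod 2)))

noncomputable instance : IsProbabilityMeasure haar := by
  unfold haar; infer_instance

/-- The dyadic interval `I_n(x) = {y : y_0 = x_0, …, y_{n-1} = x_{n-1}}`. -/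
def interval (n : ℕ) (x : WalshGroup) : Set WalshGroup := {y | ∀ j < n, y j = x j}

/-- The σ-algebra generated by the dyadic intervals `I_n(x)`, `x ∈ G`. -/
@[reducible] def sigmaAlgebra (n : ℕ) : MeasurableSpace WalshGroup :=
  MeasurableSpace.generateFrom (Set.range (interval n))

theorem measurableSet_interval (n : ℕ) (x : WalshGroup) : MeasurableSet (interval n x) := by
  have : interval n x = ⋂ j : ℕ, ⋂ _ : j < n, (fun y : WalshGroup => y j) ⁻¹' {x j} := by
    ext y; simp [interval]
  rw [this]
  exact MeasurableSet.iInter fun j => MeasurableSet.iInter fun _ =>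
    measurable_pi_apply j (MeasurableSet.of_discrete)

/-- A set that is a union of dyadic intervals of order `n` lies in the `n`-th σ-algebra. -/
theorem measurableSet_sigmaAlgebra {n : ℕ} {s : Set WalshGroup}
    (hs : ∀ x ∈ s, interval n x ⊆ s) : MeasurableSet[sigmaAlgebra n] s := by
  have hfin : (Set.range (interval n)).Finite := by
    refine (Set.finite_range (fun v : Fin n → ZMod 2 =>
      {y : WalshGroup | ∀ j : Fin n, y j = v j})).subset ?_
    rintro _ ⟨x, rfl⟩
    refine ⟨fun j => x j, ?_⟩
    ext y
    simp only [interval, Set.mem_ofPred_eq]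
    exact ⟨fun h j hj => h ⟨j, hj⟩, fun h j => h j j.2⟩
  have hU : s = ⋃₀ (interval n '' s) := by
    ext y
    constructor
    · exact fun hy => ⟨_, ⟨y, hy, rfl⟩, fun _ _ => rfl⟩
    · rintro ⟨_, ⟨x, hx, rfl⟩, hy⟩
      exact hs x hx hy
  rw [hU]
  refine MeasurableSet.sUnion (hfin.subset (Set.image_subset_range _ _)).countable ?_
  rintro _ ⟨x, -, rfl⟩
  exact MeasurableSpace.measurableSet_generateFrom ⟨x, rfl⟩

/-- The dyadic filtration of `G`. -/
def dyadicFiltration : Filtration ℕ (inferInstance : MeasurableSpace WalshGroup) where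
  seq := sigmaAlgebra
  mono' := by
    intro m n hmn
    refine MeasurableSpace.generateFrom_le ?_
    rintro _ ⟨x, rfl⟩
    refine measurableSet_sigmaAlgebra fun y hy z hz j hj => ?_
    rw [hz j (lt_of_lt_of_le hj hmn), hy j hj]
  le' := by
    intro n
    refine MeasurableSpace.generateFrom_le ?_
    rintro _ ⟨x, rfl⟩
    exact measurableSet_interval n x

/-- The binary digit `n_k ∈ {0, 1}` in the expansion `n = ∑ n_k 2 ^ k`. -/
def digit (n k : ℕ) : ℕ := (n.testBit k).toNat

/-- `ρ(n) = |n| - [n]`, where `|n| = max {j : n_j ≠ 0}` and `[n] = min {j : n_j ≠ 0}`;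
it is meant for `n ≥ 1` only. -/
noncomputable def rho (n : ℕ) : ℕ := sSup {j | digit n j ≠ 0} - sInf {j | digit n j ≠ 0}

/-- The `k`-th Rademacher function `r_k(x) = (-1) ^ {x_k}`. -/
def rademacher (k : ℕ) (x : WalshGroup) : ℝ := (-1) ^ (x k).val

/-- The `n`-th Walsh function `w_n = ∏_k r_k ^ {n_k}`; the factors with `k ≥ n` are `1`,
since then `n < 2 ^ k` and so `n_k = 0`. -/
def walsh (n : ℕ) (x : WalshGroup) : ℝ := ∏ k ∈ Finset.range n, rademacher k x ^ digit n k

/-- The `k`-th Walsh-Fourier coefficient `lim_n ∫ F_n w_k dμ` of a sequence of functions `F`;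
for a martingale the limit exists (see `tendsto_fourierCoeff`). -/
noncomputable def fourierCoeff (F : ℕ → WalshGroup → ℝ) (k : ℕ) : ℝ :=
  limUnder atTop (fun n => ∫ x, F n x * walsh k x ∂haar)

/-- The `n`-th partial sum `S_n F = ∑_{k < n} F̂(k) w_k` of the Walsh-Fourier series of `F`. -/
noncomputable def partialSum (F : ℕ → WalshGroup → ℝ) (n : ℕ) (x : WalshGroup) : ℝ :=
  ∑ k ∈ Finset.range n, fourierCoeff F k * walsh k x

/-- The maximal function `F* = sup_n |F_n|`, with values in `[0, ∞]`. -/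
noncomputable def maximalFunction (F : ℕ → WalshGroup → ℝ) (x : WalshGroup) : ℝ≥0∞ :=
  ⨆ n, ‖F n x‖ₑ

/-- The `L_p` quasi-norm `(∫ f ^ p dμ) ^ (1 / p)` of a function with values in `[0, ∞]`. -/
noncomputable def lpQuasiNorm (p : ℝ) (f : WalshGroup → ℝ≥0∞) : ℝ≥0∞ :=
  (∫⁻ x, f x ^ p ∂haar) ^ (1 / p)

/-- The weak-`L_p` quasi-norm `(sup_{t > 0} t ^ p μ(f > t)) ^ (1 / p)` of a function with values
in `[0, ∞]`. -/
noncomputable def weakLpQuasiNorm (p : ℝ) (f : WalshGroup → ℝ≥0∞) : ℝ≥0∞ :=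
  (⨆ (t : ℝ≥0) (_ : 0 < t), (t : ℝ≥0∞) ^ p * haar {x | (t : ℝ≥0∞) < f x}) ^ (1 / p)

/-- The quasi-norm `‖F‖_{H_p} = ‖F*‖_p`. -/
noncomputable def hardyNorm (p : ℝ) (F : ℕ → WalshGroup → ℝ) : ℝ≥0∞ :=
  lpQuasiNorm p (maximalFunction F)

/-- `F` belongs to the martingale Hardy space `H_p(G)`. -/
def MemHardy (p : ℝ) (F : ℕ → WalshGroup → ℝ) : Prop :=
  Martingale F dyadicFiltration haar ∧ hardyNorm p F < ∞

/-- The maximal operator `sup_k |S_{n_k} F|` along the sequence `(n_k)`. -/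
noncomputable def maximalPartialSum (n : ℕ → ℕ) (F : ℕ → WalshGroup → ℝ) (x : WalshGroup) :
    ℝ≥0∞ :=
  ⨆ k, ‖partialSum F (n k) x‖ₑ

/-- `T` is bounded from `H_p(G)` to the space of functions with the quasi-norm `N`:
there is a finite constant `C` with `N (T F) ≤ C ‖F‖_{H_p}` for all `F ∈ H_p(G)`. -/
def BoundedFromHardy (p : ℝ) (N : (WalshGroup → ℝ≥0∞) → ℝ≥0∞)
    (T : (ℕ → WalshGroup → ℝ) → WalshGroup → ℝ≥0∞) : Prop :=
  ∃ C : ℝ≥0, ∀ F, MemHardy p F → N (T F) ≤ C * hardyNorm p F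

theorem stronglyMeasurable_walsh (k : ℕ) :
    StronglyMeasurable[dyadicFiltration k] (walsh k) := by
  refine Measurable.stronglyMeasurable ?_
  intro s _
  refine measurableSet_sigmaAlgebra fun x hx y hy => ?_
  have : walsh k y = walsh k x := by
    refine Finset.prod_congr rfl fun j hj => ?_
    rw [rademacher, rademacher, hy j (Finset.mem_range.1 hj)]
  rw [Set.mem_preimage, this]
  exact hx

theorem abs_walsh (k : ℕ) (x : WalshGroup) : |walsh k x| = 1 := by
  simp [walsh, rademacher, Finset.abs_prod, abs_pow]

/-- The limit that defines the Walsh-Fourier coefficient of a martingale exists. -/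
theorem tendsto_fourierCoeff {F : ℕ → WalshGroup → ℝ}
    (hF : Martingale F dyadicFiltration haar) (k : ℕ) :
    Tendsto (fun n => ∫ x, F n x * walsh k x ∂haar) atTop (𝓝 (fourierCoeff F k)) := by
  refine tendsto_nhds_limUnder ⟨∫ x, F k x * walsh k x ∂haar, ?_⟩
  refine tendsto_const_nhds.congr' ?_
  filter_upwards [eventually_ge_atTop k] with n hn
  have hint : Integrable (fun x => F n x * walsh k x) haar := by
    refine (hF.integrable n).mul_bdd (c := 1)
      ((stronglyMeasurable_walsh k).mono (dyadicFiltration.le k)).aestronglyMeasurable ?_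
    exact Eventually.of_forall fun x => by rw [Real.norm_eq_abs, abs_walsh]
  have h1 := condExp_mul_of_stronglyMeasurable_right (stronglyMeasurable_walsh k)
    (f := F n) hint (hF.integrable n)
  have h2 := hF.2 k n hn
  have h3 := integral_condExp (μ := haar) (f := fun x => F n x * walsh k x)
    (dyadicFiltration.le k)
  rw [← h3]
  refine integral_congr_ae ?_
  filter_upwards [h1, h2] with x hx1 hx2
  have : (haar[fun x => F n x * walsh k x | dyadicFiltration k]) x = _ := hx1
  rw [this, Pi.mul_apply, hx2]

end WalshGroup

/-!
The operator `sup_k |S_{n_k}|` is bounded exactly when `ρ(n_k)` is, for the following reasons.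

*Boundedness.* Write `n = 2 ^ s * q` with `q` odd, and let `N` be the number of binary digits of
`n`, so that `N = s + ρ(n) + 1`. The Dirichlet kernel `D_n` is a sum of `q` blocks of modulus
`D_{2 ^ s} = 2 ^ s 1_{I_s(0)}`, and `S_n F` is the convolution of `F_N` with `D_n`; hence
`|S_n F(x)| ≤ q max_{I_s(x)} |F_N|` (`abs_partialSum_le`). If `ρ(n_k) ≤ R` for all `k`, then
`q ≤ 2 ^ (R + 1)`, and a large value of `sup_k |S_{n_k} F|` at `x` forces `2 ^ (R + 1) F*` to be
large on a whole interval of order `s + R + 1` inside `I_s(x)`. By the covering inequality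
`measure_exists_child_le` the distribution function of `sup_k |S_{n_k} F|` is at most `2 ^ (R + 1)`
times that of `2 ^ (R + 1) F*`, and the layer cake formula gives the strong, thus also the weak,
inequality. This half holds for every `p > 0`.

*Unboundedness.* For `2 ^ M ≤ n < 2 ^ (M + 1)` with lowest digit at `s < M`, take the martingale
that ends at `f = w_{2 ^ M} 1_{I_M(0)}` (`testMartingale`). Its maximal function is `1_{I_M(0)}`,
of quasi-norm `2 ^ (-M / p)`, while `|S_n f| = 2 ^ (s - M)` on an interval of measure
`2 ^ (-s - 1)` (`abs_partialSum_testMartingale`). The quotient of the quasi-norms is of the order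
`2 ^ ((M - s) (1 / p - 1))`, which is unbounded in `ρ(n) = M - s` as `p < 1`
(`rpow_le_of_boundedFromHardy`).
-/

namespace WalshGroup

/-! ### Haar measure, dyadic intervals and translations -/

theorem uniformOn_univ_singleton (a : ZMod 2) :
    (uniformOn Set.univ : Measure (ZMod 2)) {a} = 2⁻¹ := by
  rw [uniformOn_univ, Measure.count_singleton, ZMod.card]
  simp

theorem haar_interval (n : ℕ) (x : WalshGroup) : haar (interval n x) = 2⁻¹ ^ n := by
  have h : interval n x = Set.pi (Finset.range n : Set ℕ) (fun j => {x j}) := by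
    ext y; simp [interval, Set.mem_pi]
  rw [h, haar, Measure.infinitePi_pi _ fun _ _ => MeasurableSet.of_discrete]
  simp only [uniformOn_univ_singleton, Finset.prod_const, Finset.card_range]

theorem measurePreserving_add (v : WalshGroup) :
    MeasurePreserving (fun x : WalshGroup => x + v) haar haar := by
  have h1 (a : ZMod 2) : (uniformOn Set.univ : Measure (ZMod 2)).map (· + a) =
      uniformOn Set.univ := by
    refine Measure.ext_of_singleton fun b => ?_
    have h2 : (· + a) ⁻¹' {b} = ({b - a} : Set (ZMod 2)) := by
      ext c; simp only [Set.mem_preimage, Set.mem_singleton_iff, eq_sub_iff_add_eq]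
    rw [Measure.map_apply (measurable_of_finite _) (measurableSet_singleton b), h2,
      uniformOn_univ_singleton, uniformOn_univ_singleton]
  refine ⟨measurable_pi_lambda _ fun i => (measurable_of_finite (· + v i)).comp
    (measurable_pi_apply i), ?_⟩
  have h3 := Measure.infinitePi_map_pi (μ := fun _ : ℕ => (uniformOn Set.univ : Measure (ZMod 2)))
    (f := fun i => (· + v i)) (fun i => measurable_of_finite _)
  simp only [h1] at h3
  exact h3

theorem mem_interval_self (n : ℕ) (x : WalshGroup) : x ∈ interval n x := fun _ _ => rfl

theorem interval_eq_of_mem {n : ℕ} {x y : WalshGroup} (h : y ∈ interval n x) :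
    interval n y = interval n x := by
  ext z
  exact ⟨fun hz j hj => (hz j hj).trans (h j hj), fun hz j hj => (hz j hj).trans (h j hj).symm⟩

theorem interval_subset {m n : ℕ} (hmn : m ≤ n) (x : WalshGroup) :
    interval n x ⊆ interval m x :=
  fun _ hz j hj => hz j (hj.trans_le hmn)

theorem mem_of_measurableSet_sigmaAlgebra {n : ℕ} {s : Set WalshGroup}
    (hs : MeasurableSet[sigmaAlgebra n] s) {x y : WalshGroup} (hy : y ∈ interval n x) :
    y ∈ s ↔ x ∈ s := by
  induction s, hs using MeasurableSpace.generateFrom_induction with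
  | hC t ht =>
    obtain ⟨z, rfl⟩ := ht
    exact ⟨fun h j hj => (hy j hj).symm.trans (h j hj), fun h j hj => (hy j hj).trans (h j hj)⟩
  | empty => rfl
  | compl t _ ih => exact not_congr ih
  | iUnion t _ ih => simp only [Set.mem_iUnion, ih]

theorem eq_of_mem_interval {n : ℕ} {f : WalshGroup → ℝ}
    (hf : StronglyMeasurable[dyadicFiltration n] f) {x y : WalshGroup}
    (hy : y ∈ interval n x) : f y = f x := by
  have h := hf.measurable (measurableSet_singleton (f x))
  exact (mem_of_measurableSet_sigmaAlgebra h hy).2 rfl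

theorem stronglyMeasurable_of_eq {n : ℕ} {f : WalshGroup → ℝ}
    (hf : ∀ x, ∀ y ∈ interval n x, f y = f x) :
    StronglyMeasurable[dyadicFiltration n] f := by
  refine Measurable.stronglyMeasurable fun s _ => measurableSet_sigmaAlgebra fun x hx y hy => ?_
  rw [Set.mem_preimage, hf x y hy]
  exact hx

/-! ### A covering inequality -/

/-- Intersecting a union `A` of intervals of order `s` with `B` loses at most the factor `2 ^ r` if
each of these intervals has a descendant of order `s + r` inside `B`: each of the
`2 ^ r` translations in the coordinates `s, …, s + r - 1` preserves `A`, and together they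
carry every point of `A` into any prescribed descendant of order `s + r` of its interval. -/
theorem measure_le_two_pow_mul_inter {s r : ℕ} {A B : Set WalshGroup} (hA : MeasurableSet A)
    (hB : MeasurableSet B) (hsat : ∀ x ∈ A, interval s x ⊆ A)
    (hAB : ∀ x ∈ A, ∃ t ∈ interval s x, interval (s + r) t ⊆ B) :
    haar A ≤ 2 ^ r * haar (A ∩ B) := by
  let v (c : Fin r → ZMod 2) : WalshGroup := fun j =>
    if h : s ≤ j ∧ j < s + r then c ⟨j - s, by omega⟩ else 0
  have hcover : A ⊆ ⋃ c : Fin r → ZMod 2, (fun x => x + v c) ⁻¹' (A ∩ B) := by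
    intro x hx
    obtain ⟨t, ht, htB⟩ := hAB x hx
    refine Set.mem_iUnion.2 ⟨fun i => t (s + i) - x (s + i), ?_, ?_⟩
    · refine hsat x hx fun j hj => ?_
      simp [v, hj.not_ge]
    · refine htB fun j hj => ?_
      by_cases hsj : s ≤ j
      · simp [v, hsj, hj]
      · simpa [v, hsj] using (ht j (not_le.1 hsj)).symm
  calc haar A ≤ haar (⋃ c : Fin r → ZMod 2, (fun x => x + v c) ⁻¹' (A ∩ B)) :=
        measure_mono hcover
    _ ≤ ∑ c : Fin r → ZMod 2, haar ((fun x => x + v c) ⁻¹' (A ∩ B)) :=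
        measure_iUnion_fintype_le _ _
    _ = ∑ _c : Fin r → ZMod 2, haar (A ∩ B) := Finset.sum_congr rfl fun c _ =>
        (measurePreserving_add (v c)).measure_preimage (hA.inter hB).nullMeasurableSet
    _ = 2 ^ r * haar (A ∩ B) := by simp [ZMod.card]

/-- A weak-type bound for the points having some dyadic interval with a descendant of relative
order `r` inside `B`. Splitting according to the first order `s` that succeeds makes the pieces
disjoint and saturated by intervals of order `s`. -/
theorem measure_exists_child_le {r : ℕ} {B : Set WalshGroup} (hB : MeasurableSet B) :
    haar {x | ∃ s, ∃ t ∈ interval s x, interval (s + r) t ⊆ B} ≤ 2 ^ r * haar B := by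
  let E (s : ℕ) : Set WalshGroup := {x | ∃ t ∈ interval s x, interval (s + r) t ⊆ B}
  have hEsat {s m : ℕ} (hsm : s ≤ m) {x y : WalshGroup} (hy : y ∈ interval m x) :
      y ∈ E s ↔ x ∈ E s := by
    simp only [E, Set.mem_ofPred_eq, interval_eq_of_mem (interval_subset hsm x hy)]
  let A : ℕ → Set WalshGroup := disjointed E
  have hAsat {s : ℕ} {x y : WalshGroup} (hx : x ∈ A s) (hy : y ∈ interval s x) : y ∈ A s := by
    simp only [A, disjointed_eq_inter_compl, Set.mem_inter_iff, Set.mem_iInter,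
      Set.mem_compl_iff] at hx ⊢
    exact ⟨(hEsat le_rfl hy).2 hx.1, fun j hj h => hx.2 j hj ((hEsat hj.le hy).1 h)⟩
  have hAmeas (s : ℕ) : MeasurableSet (A s) :=
    dyadicFiltration.le s _ (measurableSet_sigmaAlgebra fun x hx y hy => hAsat hx hy)
  have hU : {x | ∃ s, ∃ t ∈ interval s x, interval (s + r) t ⊆ B} = ⋃ s, A s := by
    rw [iUnion_disjointed]
    ext x; simp [E]
  calc haar {x | ∃ s, ∃ t ∈ interval s x, interval (s + r) t ⊆ B}
      ≤ ∑' s, haar (A s) := hU ▸ measure_iUnion_le A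
    _ ≤ ∑' s, 2 ^ r * haar (A s ∩ B) := ENNReal.tsum_le_tsum fun s =>
        measure_le_two_pow_mul_inter (hAmeas s) hB (fun x hx y hy => hAsat hx hy)
          fun x hx => disjointed_subset E s hx
    _ = 2 ^ r * haar (⋃ s, A s ∩ B) := by
        rw [ENNReal.tsum_mul_left, measure_iUnion _ fun s => (hAmeas s).inter hB]
        exact fun i j hij => ((disjoint_disjointed E hij).mono Set.inter_subset_left
          Set.inter_subset_left)
    _ ≤ 2 ^ r * haar B := by
        gcongr
        exact Set.iUnion_subset fun s => Set.inter_subset_right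

/-! ### Distribution functions and quasi-norms -/

/-- The layer cake formula for a function with values in `[0, ∞]`. -/
theorem lintegral_eq_lintegral_measure_lt {f : WalshGroup → ℝ≥0∞} (hf : Measurable f) :
    ∫⁻ x, f x ∂haar = ∫⁻ t in Set.Ioi (0 : ℝ), haar {x | ENNReal.ofReal t < f x} := by
  have hS : MeasurableSet {q : WalshGroup × ℝ | ENNReal.ofReal q.2 < f q.1} :=
    measurableSet_lt (ENNReal.measurable_ofReal.comp measurable_snd) (hf.comp measurable_fst)
  have h1 := Measure.prod_apply (μ := haar) (ν := volume.restrict (Set.Ioi (0 : ℝ))) hS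
  have h2 := Measure.prod_apply_symm (μ := haar) (ν := volume.restrict (Set.Ioi (0 : ℝ))) hS
  rw [h1] at h2
  refine Eq.trans (lintegral_congr fun x => ?_) h2
  have hm : MeasurableSet (Prod.mk x ⁻¹' {q : WalshGroup × ℝ | ENNReal.ofReal q.2 < f q.1}) :=
    measurable_prodMk_left hS
  rw [Measure.restrict_apply hm]
  by_cases hx : f x = ∞
  · have : Prod.mk x ⁻¹' {q : WalshGroup × ℝ | ENNReal.ofReal q.2 < f q.1} ∩ Set.Ioi 0 =
        Set.Ioi 0 := by
      ext t; simp [hx]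
    rw [this, hx, Real.volume_Ioi]
  · have : Prod.mk x ⁻¹' {q : WalshGroup × ℝ | ENNReal.ofReal q.2 < f q.1} ∩ Set.Ioi 0 =
        Set.Ioo 0 (f x).toReal := by
      ext t
      simp only [Set.mem_inter_iff, Set.mem_preimage, Set.mem_ofPred_eq, Set.mem_Ioi, Set.mem_Ioo]
      refine ⟨fun h => ⟨h.2, ?_⟩, fun h => ⟨?_, h.1⟩⟩
      · exact (ENNReal.ofReal_lt_iff_lt_toReal h.2.le hx).1 h.1
      · exact (ENNReal.ofReal_lt_iff_lt_toReal h.1.le hx).2 h.2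
    rw [this, Real.volume_Ioo, sub_zero, ENNReal.ofReal_toReal hx]

theorem lpQuasiNorm_le_of_measure_lt_le {p : ℝ} (hp : 0 < p) {f g : WalshGroup → ℝ≥0∞}
    (hf : Measurable f) (hg : Measurable g) {C : ℝ≥0∞}
    (h : ∀ l : ℝ≥0∞, haar {x | l < f x} ≤ C * haar {x | l < g x}) :
    lpQuasiNorm p f ≤ C ^ (1 / p) * lpQuasiNorm p g := by
  have hlt (l : ℝ≥0∞) (φ : WalshGroup → ℝ≥0∞) : {x | l < φ x ^ p} = {x | l ^ p⁻¹ < φ x} := by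
    ext x
    exact (ENNReal.rpow_inv_lt_iff hp).symm
  have hanti : Measurable fun t : ℝ => haar {x | ENNReal.ofReal t < g x ^ p} := by
    refine Antitone.measurable fun a b hab => measure_mono fun x hx => ?_
    exact (ENNReal.ofReal_le_ofReal hab).trans_lt hx
  have key : ∫⁻ x, f x ^ p ∂haar ≤ C * ∫⁻ x, g x ^ p ∂haar := by
    rw [lintegral_eq_lintegral_measure_lt (hf.pow_const p),
      lintegral_eq_lintegral_measure_lt (hg.pow_const p), ← lintegral_const_mul _ hanti]
    refine lintegral_mono fun t => ?_
    simp only [hlt]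
    exact h _
  rw [lpQuasiNorm, lpQuasiNorm, ← ENNReal.mul_rpow_of_nonneg _ _ (by positivity)]
  exact ENNReal.rpow_le_rpow key (by positivity)

theorem lpQuasiNorm_const_mul {p : ℝ} (hp : 0 < p) {c : ℝ≥0∞} {f : WalshGroup → ℝ≥0∞}
    (hf : Measurable f) : lpQuasiNorm p (fun x => c * f x) = c * lpQuasiNorm p f := by
  simp only [lpQuasiNorm, ENNReal.mul_rpow_of_nonneg _ _ hp.le]
  rw [lintegral_const_mul _ (hf.pow_const p), ENNReal.mul_rpow_of_nonneg _ _ (by positivity),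
    one_div, ENNReal.rpow_rpow_inv hp.ne']

theorem weakLpQuasiNorm_le_lpQuasiNorm {p : ℝ} (hp : 0 < p) {f : WalshGroup → ℝ≥0∞}
    (hf : Measurable f) : weakLpQuasiNorm p f ≤ lpQuasiNorm p f := by
  refine ENNReal.rpow_le_rpow (iSup₂_le fun t _ => ?_) (by positivity)
  refine le_trans ?_ (mul_meas_ge_le_lintegral (hf.pow_const p) ((t : ℝ≥0∞) ^ p))
  gcongr
  exact fun hx => ENNReal.rpow_le_rpow hx.le hp.le

theorem le_weakLpQuasiNorm {p : ℝ} (hp : 0 < p) (f : WalshGroup → ℝ≥0∞) {t : ℝ≥0} (ht : 0 < t) :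
    t * haar {x | (t : ℝ≥0∞) < f x} ^ (1 / p) ≤ weakLpQuasiNorm p f := by
  have h := le_iSup₂ (f := fun (t : ℝ≥0) (_ : 0 < t) =>
    (t : ℝ≥0∞) ^ p * haar {x | (t : ℝ≥0∞) < f x}) t ht
  refine le_trans (le_of_eq ?_) (ENNReal.rpow_le_rpow h (by positivity : 0 ≤ 1 / p))
  rw [ENNReal.mul_rpow_of_nonneg _ _ (by positivity), one_div, ENNReal.rpow_rpow_inv hp.ne']

/-! ### Walsh functions and Dirichlet kernels -/

theorem rademacher_add (k : ℕ) (x y : WalshGroup) :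
    rademacher k (x + y) = rademacher k x * rademacher k y := by
  rw [rademacher, rademacher, rademacher, Pi.add_apply, ZMod.val_add, ← neg_one_pow_eq_pow_mod_two,
    pow_add]

theorem rademacher_eq_neg_one {k : ℕ} {x : WalshGroup} (hx : x k = 1) :
    rademacher k x = -1 := by
  rw [rademacher, hx, ZMod.val_one, pow_one]

theorem walsh_add (k : ℕ) (x y : WalshGroup) : walsh k (x + y) = walsh k x * walsh k y := by
  simp only [walsh, rademacher_add, mul_pow, Finset.prod_mul_distrib]

theorem walsh_eq_prod {n N : ℕ} (h : n < 2 ^ N) (x : WalshGroup) :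
    walsh n x = ∏ k ∈ Finset.range N, rademacher k x ^ digit n k := by
  have hdigit {k : ℕ} (hk : n < 2 ^ k) : digit n k = 0 := by
    simp [digit, Nat.testBit_lt_two_pow hk]
  have hext {a b : ℕ} (hab : a ≤ b) (ha : n < 2 ^ a) :
      ∏ k ∈ Finset.range a, rademacher k x ^ digit n k =
        ∏ k ∈ Finset.range b, rademacher k x ^ digit n k := by
    refine Finset.prod_subset (Finset.range_subset_range.2 hab) fun k _ hk => ?_
    rw [hdigit (ha.trans_le (Nat.pow_le_pow_right two_pos (by simpa using hk))), pow_zero]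
  rcases le_total n N with hN | hN
  · exact hext hN Nat.lt_two_pow_self
  · exact (hext hN h).symm

theorem walsh_eq_one {k s : ℕ} (hk : k < 2 ^ s) {x : WalshGroup} (hx : ∀ j < s, x j = 0) :
    walsh k x = 1 := by
  rw [walsh_eq_prod hk]
  refine Finset.prod_eq_one fun j hj => ?_
  simp [rademacher, hx j (Finset.mem_range.1 hj)]

theorem walsh_two_pow_mul_add {s i : ℕ} (hi : i < 2 ^ s) (j : ℕ) (x : WalshGroup) :
    walsh (2 ^ s * j + i) x = walsh (2 ^ s * j) x * walsh i x := by
  obtain ⟨N, hN⟩ : ∃ N, 2 ^ s * j + i < 2 ^ N := ⟨_, Nat.lt_two_pow_self⟩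
  rw [walsh_eq_prod hN, walsh_eq_prod (n := 2 ^ s * j) (N := N) (by omega),
    walsh_eq_prod (n := i) (N := N) (by omega), ← Finset.prod_mul_distrib]
  refine Finset.prod_congr rfl fun k _ => ?_
  rw [← pow_add]
  congr 1
  simp only [digit, Nat.testBit_two_pow_mul_add j hi, Nat.testBit_two_pow_mul]
  by_cases hk : k < s
  · simp [hk]
  · have h : i < 2 ^ k := hi.trans_le (Nat.pow_le_pow_right two_pos (not_lt.1 hk))
    simp [hk, not_lt.1 hk, Nat.testBit_lt_two_pow h]

theorem walsh_two_pow (s : ℕ) (x : WalshGroup) : walsh (2 ^ s) x = rademacher s x := by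
  rw [walsh_eq_prod (Nat.pow_lt_pow_right one_lt_two (Nat.lt_succ_self s)),
    Finset.prod_eq_single s]
  · simp [digit]
  · intro k _ hk
    simp [digit, Nat.testBit_two_pow_of_ne hk.symm]
  · simp

/-- The Walsh-Dirichlet kernel `D_n = ∑_{k < n} w_k`. -/
noncomputable def dirichlet (n : ℕ) (x : WalshGroup) : ℝ := ∑ k ∈ Finset.range n, walsh k x

theorem dirichlet_two_pow_mul_add {s i : ℕ} (hi : i ≤ 2 ^ s) (j : ℕ) (x : WalshGroup) :
    dirichlet (2 ^ s * j + i) x = dirichlet (2 ^ s * j) x + walsh (2 ^ s * j) x * dirichlet i x := by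
  rw [dirichlet, Finset.sum_range_add, dirichlet, dirichlet, Finset.mul_sum]
  congr 1
  exact Finset.sum_congr rfl fun k hk =>
    walsh_two_pow_mul_add ((Finset.mem_range.1 hk).trans_le hi) j x

theorem dirichlet_two_pow_mul (s q : ℕ) (x : WalshGroup) :
    dirichlet (2 ^ s * q) x =
      dirichlet (2 ^ s) x * ∑ j ∈ Finset.range q, walsh (2 ^ s * j) x := by
  induction q with
  | zero => simp [dirichlet]
  | succ q ih =>
    rw [Nat.mul_succ, dirichlet_two_pow_mul_add le_rfl, ih, Finset.sum_range_succ]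
    ring

theorem dirichlet_two_pow_of_forall {s : ℕ} {x : WalshGroup} (hx : ∀ j < s, x j = 0) :
    dirichlet (2 ^ s) x = 2 ^ s := by
  rw [dirichlet, Finset.sum_congr rfl fun k hk => walsh_eq_one (Finset.mem_range.1 hk) hx]
  simp

theorem dirichlet_two_pow_of_ne {s j : ℕ} (hj : j < s) {x : WalshGroup} (hx : x j ≠ 0) :
    dirichlet (2 ^ s) x = 0 := by
  -- The block of length `2 ^ (j + 1)` is `D_{2 ^ j} * (1 + r_j)`, and `r_j x = -1`.
  have h0 : rademacher j x = -1 := by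
    refine rademacher_eq_neg_one ?_
    generalize x j = a at hx
    fin_cases a
    · exact absurd rfl hx
    · rfl
  have h1 : dirichlet (2 ^ (j + 1)) x = 0 := by
    have h := dirichlet_two_pow_mul_add (le_refl (2 ^ j)) 1 x
    rw [mul_one, walsh_two_pow, h0] at h
    rw [pow_succ, mul_two, h]
    ring
  rw [show s = (j + 1) + (s - (j + 1)) by omega, pow_add, dirichlet_two_pow_mul, h1, zero_mul]

/-- If the lowest nonzero digit of `x` and that of `n = 2 ^ s * (2 * u + 1)` sit at the same place
`s`, then the blocks of `D_n` cancel in pairs and one block remains. -/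
theorem abs_dirichlet_of_lowest {s : ℕ} (u : ℕ) {x : WalshGroup} (hx : ∀ j < s, x j = 0)
    (hs : x s = 1) : |dirichlet (2 ^ s * (2 * u + 1)) x| = 2 ^ s := by
  have hr : rademacher s x = -1 := rademacher_eq_neg_one hs
  have hpair : ∑ j ∈ Finset.range (2 * u), walsh (2 ^ s * j) x = 0 := by
    induction u with
    | zero => simp
    | succ u ih =>
      have h : walsh (2 ^ s * (2 * u + 1)) x = walsh (2 ^ s * (2 * u)) x * -1 := by
        have h := walsh_two_pow_mul_add (Nat.pow_lt_pow_right one_lt_two (Nat.lt_succ_self s)) u x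
        rw [walsh_two_pow, hr] at h
        rw [show 2 ^ s * (2 * u + 1) = 2 ^ (s + 1) * u + 2 ^ s by ring, h,
          show 2 ^ s * (2 * u) = 2 ^ (s + 1) * u by ring]
      rw [show 2 * (u + 1) = 2 * u + 1 + 1 by ring, Finset.sum_range_succ, Finset.sum_range_succ,
        ih, h]
      ring
  rw [dirichlet_two_pow_mul, Finset.sum_range_succ, hpair, zero_add,
    dirichlet_two_pow_of_forall hx, abs_mul, abs_walsh, mul_one, abs_of_pos (by positivity)]

theorem abs_dirichlet_le (n : ℕ) (x : WalshGroup) : |dirichlet n x| ≤ n := by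
  refine (Finset.abs_sum_le_sum_abs _ _).trans ?_
  simp [abs_walsh]

theorem dirichlet_add_of_forall {n N : ℕ} (hn : n ≤ 2 ^ N) (x : WalshGroup) {y : WalshGroup}
    (hy : ∀ j < N, y j = 0) : dirichlet n (x + y) = dirichlet n x := by
  refine Finset.sum_congr rfl fun k hk => ?_
  rw [walsh_add, walsh_eq_one ((Finset.mem_range.1 hk).trans_le hn) hy, mul_one]

theorem measurable_walsh (k : ℕ) : Measurable (walsh k) :=
  ((stronglyMeasurable_walsh k).mono (dyadicFiltration.le k)).measurable

/-! ### Binary digits of the index -/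

/-- The extreme binary digits of `n` and `ρ(n)`. -/
theorem exists_rho_eq {n : ℕ} (hn : 0 < n) :
    ∃ s M u : ℕ, s ≤ M ∧ rho n = M - s ∧ 2 ^ M ≤ n ∧ n < 2 ^ (M + 1) ∧
      n = 2 ^ s * (2 * u + 1) := by
  set S : Set ℕ := {j | digit n j ≠ 0} with hS
  have hmem (j : ℕ) : j ∈ S ↔ n.testBit j = true := by simp [hS, digit]
  have hne : S.Nonempty := by
    obtain ⟨j, hj⟩ := Nat.exists_testBit_of_ne_zero hn.ne'
    exact ⟨j, (hmem j).2 hj⟩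
  have hbdd : BddAbove S := by
    refine ⟨n, fun j hj => ?_⟩
    exact (Nat.lt_two_pow_self.trans_le (Nat.ge_two_pow_of_testBit ((hmem j).1 hj))).le
  have hs := (hmem _).1 (Nat.sInf_mem hne)
  have hM := (hmem _).1 (Nat.sSup_mem hne hbdd)
  have hdvd : 2 ^ sInf S ∣ n := by
    refine Nat.dvd_of_mod_eq_zero (Nat.eq_of_testBit_eq fun j => ?_)
    rw [Nat.testBit_mod_two_pow, Nat.zero_testBit]
    by_cases hj : j < sInf S
    · have := Nat.notMem_of_lt_sInf hj
      rw [hmem] at this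
      simp [this]
    · simp [hj]
  obtain ⟨q, hq⟩ := hdvd
  have hodd : Odd q := by
    rw [hq, Nat.testBit_two_pow_mul] at hs
    simpa [Nat.odd_iff] using hs
  obtain ⟨u, rfl⟩ := hodd
  refine ⟨sInf S, sSup S, u, Nat.sInf_le (Nat.sSup_mem hne hbdd), rfl,
    Nat.ge_two_pow_of_testBit hM, ?_, hq⟩
  refine Nat.lt_pow_two_of_testBit _ fun j hj => ?_
  by_contra h
  have := le_csSup hbdd ((hmem j).2 (by simpa using h))
  omega

/-! ### Partial sums of martingales -/

theorem stronglyMeasurable_walsh_of_lt {k N : ℕ} (hk : k < 2 ^ N) :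
    StronglyMeasurable[dyadicFiltration N] (walsh k) := by
  refine stronglyMeasurable_of_eq fun x y hy => ?_
  rw [walsh_eq_prod hk, walsh_eq_prod hk]
  refine Finset.prod_congr rfl fun j hj => ?_
  rw [rademacher, rademacher, hy j (Finset.mem_range.1 hj)]

theorem integrable_mul_walsh {f : WalshGroup → ℝ} (hf : Integrable f haar) (k : ℕ) :
    Integrable (fun x => f x * walsh k x) haar :=
  hf.mul_bdd (c := 1) (measurable_walsh k).aestronglyMeasurable
    (Eventually.of_forall fun x => by rw [Real.norm_eq_abs, abs_walsh])

/-- Already the `N`-th term of a martingale determines its coefficients of order below `2 ^ N`. -/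
theorem fourierCoeff_eq_integral {F : ℕ → WalshGroup → ℝ}
    (hF : Martingale F dyadicFiltration haar) {k N : ℕ} (hk : k < 2 ^ N) :
    fourierCoeff F k = ∫ x, F N x * walsh k x ∂haar := by
  refine tendsto_nhds_unique (tendsto_fourierCoeff hF k) (tendsto_const_nhds.congr' ?_)
  filter_upwards [eventually_ge_atTop N] with n hn
  have hint := integrable_mul_walsh (hF.integrable n) k
  have h1 := condExp_mul_of_stronglyMeasurable_right (stronglyMeasurable_walsh_of_lt hk)
    (f := F n) hint (hF.integrable n)
  rw [← integral_condExp (μ := haar) (f := fun x => F n x * walsh k x) (dyadicFiltration.le N)]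
  refine integral_congr_ae ?_
  filter_upwards [h1, hF.2 N n hn] with x hx1 hx2
  have : (haar[fun x => F n x * walsh k x | dyadicFiltration N]) x = _ := hx1
  rw [this, Pi.mul_apply, hx2]

/-- The partial sum as a convolution with the Dirichlet kernel. -/
theorem partialSum_eq_integral {F : ℕ → WalshGroup → ℝ}
    (hF : Martingale F dyadicFiltration haar) {n N : ℕ} (hn : n ≤ 2 ^ N) (x : WalshGroup) :
    partialSum F n x = ∫ t, F N t * dirichlet n (x + t) ∂haar := by
  have h (t : WalshGroup) : F N t * dirichlet n (x + t) =
      ∑ k ∈ Finset.range n, F N t * walsh k t * walsh k x := by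
    rw [dirichlet, Finset.mul_sum]
    refine Finset.sum_congr rfl fun k _ => ?_
    rw [walsh_add]
    ring
  simp only [h]
  rw [integral_finsetSum _ fun k _ =>
    (integrable_mul_walsh (hF.integrable N) k).mul_const (walsh k x)]
  refine Finset.sum_congr rfl fun k hk => ?_
  rw [integral_mul_const,
    fourierCoeff_eq_integral hF ((Finset.mem_range.1 hk).trans_le hn)]

/-- For `n = 2 ^ s * q` the kernel `D_n(x + ·)` is supported by `I_s(x)` and bounded by
`2 ^ s * q = q / μ(I_s(x))`. -/
theorem abs_partialSum_le {F : ℕ → WalshGroup → ℝ}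
    (hF : Martingale F dyadicFiltration haar) {s q N : ℕ} (hn : 2 ^ s * q ≤ 2 ^ N)
    {x : WalshGroup} {c : ℝ} (hc : ∀ t ∈ interval s x, |F N t| ≤ c) :
    |partialSum F (2 ^ s * q) x| ≤ q * c := by
  have hc0 : 0 ≤ c := (abs_nonneg _).trans (hc x (mem_interval_self s x))
  have hsupp : ∀ t ∉ interval s x, F N t * dirichlet (2 ^ s * q) (x + t) = 0 := by
    intro t ht
    obtain ⟨j, hj, hne⟩ : ∃ j < s, t j ≠ x j := by simpa [interval] using ht
    have h : (x + t) j ≠ 0 := fun h => hne (CharTwo.add_eq_zero.1 h).symm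
    rw [dirichlet_two_pow_mul, dirichlet_two_pow_of_ne hj h, zero_mul, mul_zero]
  rw [partialSum_eq_integral hF hn, ← setIntegral_eq_integral_of_forall_compl_eq_zero hsupp,
    ← Real.norm_eq_abs]
  refine (norm_setIntegral_le_of_norm_le_const (C := c * (2 ^ s * q))
    (measure_lt_top _ _) fun t ht => ?_).trans (le_of_eq ?_)
  · rw [norm_mul]
    refine mul_le_mul (hc t ht) ?_ (norm_nonneg _) hc0
    exact_mod_cast abs_dirichlet_le (2 ^ s * q) (x + t)
  · rw [measureReal_def, haar_interval, ENNReal.toReal_pow, ENNReal.toReal_inv,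
      ENNReal.toReal_ofNat, inv_pow]
    field_simp

theorem measurable_partialSum (F : ℕ → WalshGroup → ℝ) (n : ℕ) : Measurable (partialSum F n) :=
  Finset.measurable_fun_sum _ fun k _ => (measurable_walsh k).const_mul _

theorem measurable_maximalPartialSum (n : ℕ → ℕ) (F : ℕ → WalshGroup → ℝ) :
    Measurable (maximalPartialSum n F) :=
  Measurable.iSup fun k => (measurable_partialSum F (n k)).enorm

theorem measurable_maximalFunction {F : ℕ → WalshGroup → ℝ}
    (hF : Martingale F dyadicFiltration haar) : Measurable (maximalFunction F) :=
  Measurable.iSup fun m =>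
    ((hF.stronglyMeasurable m).mono (dyadicFiltration.le m)).measurable.enorm

/-! ### Boundedness when `ρ` is bounded -/

/-- If `|S_{n_k} F(x)|` is large, then `|F_N|` is large on an interval of order at most `s + R + 1`
inside `I_s(x)`, where `s` is the lowest digit of `n_k`; the covering inequality applies. -/
theorem measure_maximalPartialSum_le {n : ℕ → ℕ} (hpos : ∀ k, 0 < n k) {R : ℕ}
    (hR : ∀ k, rho (n k) ≤ R) {F : ℕ → WalshGroup → ℝ}
    (hF : Martingale F dyadicFiltration haar) (l : ℝ≥0∞) :
    haar {x | l < maximalPartialSum n F x} ≤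
      2 ^ (R + 1) * haar {x | l < 2 ^ (R + 1) * maximalFunction F x} := by
  refine le_trans (measure_mono fun x hx => ?_) (measure_exists_child_le (r := R + 1)
    (measurableSet_lt measurable_const ((measurable_maximalFunction hF).const_mul _)))
  obtain ⟨k, hk⟩ := lt_iSup_iff.1 (show l < maximalPartialSum n F x from hx)
  obtain ⟨s, M, u, hsM, hrho, -, hlt, hnk⟩ := exists_rho_eq (hpos k)
  have hMR : M + 1 ≤ s + (R + 1) := by
    have := hR k
    omega
  have hq : 2 * u + 1 ≤ 2 ^ (R + 1) := by
    have h : 2 ^ s * (2 * u + 1) ≤ 2 ^ s * 2 ^ (R + 1) := by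
      rw [← hnk, ← pow_add]
      exact hlt.le.trans (Nat.pow_le_pow_right two_pos hMR)
    exact Nat.le_of_mul_le_mul_left h (by positivity)
  refine ⟨s, ?_⟩
  by_contra hcon
  have hle : ∀ t ∈ interval s x, 2 ^ (R + 1) * ‖F (M + 1) t‖ₑ ≤ l := by
    intro t ht
    by_contra hl
    refine hcon ⟨t, ht, fun y hy => (not_le.1 hl).trans_le ?_⟩
    rw [← eq_of_mem_interval (hF.stronglyMeasurable (M + 1)) (interval_subset hMR t hy)]
    gcongr
    exact le_iSup (fun m => ‖F m y‖ₑ) (M + 1)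
  have hl : l ≠ ∞ := (hk.trans_le le_top).ne
  have h := abs_partialSum_le hF (hnk ▸ hlt.le) (c := l.toReal / 2 ^ (R + 1)) (x := x)
    fun t ht => by
      have h := ENNReal.toReal_mono hl (hle t ht)
      rw [ENNReal.toReal_mul, ENNReal.toReal_pow, ENNReal.toReal_ofNat, toReal_enorm,
        Real.norm_eq_abs] at h
      rw [le_div_iff₀ (by positivity)]
      linarith
  have h2 : |partialSum F (n k) x| ≤ l.toReal := by
    rw [hnk]
    refine h.trans ?_
    rw [mul_div_assoc', div_le_iff₀ (by positivity), mul_comm]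
    gcongr
    exact_mod_cast hq
  refine hk.not_ge ?_
  rw [Real.enorm_eq_ofReal_abs]
  exact ENNReal.ofReal_le_of_le_toReal h2

theorem boundedFromHardy_of_bddAbove {p : ℝ} (hp : 0 < p) {n : ℕ → ℕ} (hpos : ∀ k, 0 < n k)
    (hb : BddAbove (Set.range fun k => rho (n k))) :
    BoundedFromHardy p (lpQuasiNorm p) (maximalPartialSum n) := by
  obtain ⟨R, hR⟩ := hb
  refine ⟨((2 ^ (R + 1)) ^ (1 / p) * 2 ^ (R + 1) : ℝ≥0), fun F hF => ?_⟩
  have hm := measurable_maximalFunction hF.1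
  have h := lpQuasiNorm_le_of_measure_lt_le hp (measurable_maximalPartialSum n F)
    (hm.const_mul (2 ^ (R + 1)))
    (measure_maximalPartialSum_le hpos (fun k => hR ⟨k, rfl⟩) hF.1)
  rw [lpQuasiNorm_const_mul hp hm, ← mul_assoc] at h
  refine h.trans (le_of_eq ?_)
  rw [ENNReal.coe_mul, ENNReal.coe_rpow_of_nonneg _ (by positivity)]
  push_cast
  rfl

theorem BoundedFromHardy.weak {p : ℝ} (hp : 0 < p) {n : ℕ → ℕ}
    (h : BoundedFromHardy p (lpQuasiNorm p) (maximalPartialSum n)) :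
    BoundedFromHardy p (weakLpQuasiNorm p) (maximalPartialSum n) := by
  obtain ⟨C, hC⟩ := h
  exact ⟨C, fun F hF =>
    (weakLpQuasiNorm_le_lpQuasiNorm hp (measurable_maximalPartialSum n F)).trans (hC F hF)⟩

/-! ### A martingale with one nonzero difference, and unboundedness -/

/-- The martingale that vanishes up to the time `M` and equals `w_{2 ^ M} 1_{I_M(0)}` afterwards:
up to the factor `2 ^ M` its final value is `D_{2 ^ (M + 1)} - D_{2 ^ M}`. -/
noncomputable def testMartingale (M m : ℕ) : WalshGroup → ℝ :=
  if m ≤ M then 0 else (interval M 0).indicator (walsh (2 ^ M))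

/-- The translation by the `M`-th unit vector changes the sign of `w_{2 ^ M}`. -/
theorem integral_mul_walsh_two_pow_eq_zero {M : ℕ} {g : WalshGroup → ℝ}
    (hg : ∀ x, ∀ y ∈ interval M x, g y = g x) :
    ∫ x, g x * walsh (2 ^ M) x ∂haar = 0 := by
  set e : WalshGroup := Pi.single M 1 with he
  have hmp := measurePreserving_add e
  have hgm : Measurable fun x => g x * walsh (2 ^ M) x :=
    (((stronglyMeasurable_of_eq hg).mono (dyadicFiltration.le M)).measurable).mul
      (measurable_walsh _)
  have h : ∫ x, g x * walsh (2 ^ M) x ∂haar = ∫ x, -(g x * walsh (2 ^ M) x) ∂haar := by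
    conv_lhs => rw [← hmp.map_eq]
    rw [integral_map hmp.measurable.aemeasurable hgm.aestronglyMeasurable]
    refine integral_congr_ae (Eventually.of_forall fun x => ?_)
    have h1 : g (x + e) = g x := hg x _ fun j hj => by simp [he, hj.ne]
    have h2 : walsh (2 ^ M) e = -1 := by
      rw [walsh_two_pow, rademacher_eq_neg_one (by simp [he])]
    simp only [h1, walsh_add, h2]
    ring
  rw [integral_neg] at h
  linarith

theorem integrable_indicator_walsh (M : ℕ) :
    Integrable ((interval M 0).indicator (walsh (2 ^ M))) haar :=
  (Integrable.of_bound (measurable_walsh _).aestronglyMeasurable 1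
    (Eventually.of_forall fun x => (abs_walsh _ x).le)).indicator (measurableSet_interval M 0)

theorem indicator_interval_eq {M : ℕ} {x y : WalshGroup} (hy : y ∈ interval M x)
    (a : ℝ) : (interval M 0).indicator (fun _ => a) y =
      (interval M 0).indicator (fun _ => a) x := by
  have h : y ∈ interval M 0 ↔ x ∈ interval M 0 :=
    mem_of_measurableSet_sigmaAlgebra (MeasurableSpace.measurableSet_generateFrom ⟨0, rfl⟩) hy
  by_cases hx : x ∈ interval M 0 <;> simp [h, hx]

theorem indicator_walsh_apply (M : ℕ) (x : WalshGroup) :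
    (interval M 0).indicator (walsh (2 ^ M)) x =
      (interval M 0).indicator (fun _ => (1 : ℝ)) x * walsh (2 ^ M) x := by
  by_cases hx : x ∈ interval M 0 <;> simp [hx]

theorem martingale_testMartingale (M : ℕ) :
    Martingale (testMartingale M) dyadicFiltration haar := by
  have hsm : StronglyMeasurable[dyadicFiltration (M + 1)]
      ((interval M 0).indicator (walsh (2 ^ M))) :=
    (stronglyMeasurable_walsh_of_lt (Nat.pow_lt_pow_right one_lt_two (Nat.lt_succ_self M))).indicator
      (dyadicFiltration.mono (Nat.le_succ M) _
        (MeasurableSpace.measurableSet_generateFrom ⟨0, rfl⟩))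
  refine ⟨fun m => ?_, fun i j hij => ?_⟩
  · rw [testMartingale]
    split_ifs with h
    · exact stronglyMeasurable_zero
    · exact hsm.mono (dyadicFiltration.mono (by omega))
  · by_cases hj : j ≤ M
    · simp only [testMartingale, hj, hij.trans hj, if_true]
      rw [condExp_zero]
    · by_cases hi : i ≤ M
      · simp only [testMartingale, hj, hi, if_true, if_false]
        refine (ae_eq_condExp_of_forall_setIntegral_eq (dyadicFiltration.le i)
          (integrable_indicator_walsh M) (fun _ _ _ => integrableOn_zero) (fun A hA _ => ?_)
          stronglyMeasurable_zero.aestronglyMeasurable).symm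
        rw [← integral_indicator (f := (interval M 0).indicator (walsh (2 ^ M)))
          (dyadicFiltration.le i A hA)]
        have h (x : WalshGroup) : A.indicator ((interval M 0).indicator (walsh (2 ^ M))) x =
            (A.indicator 1 x * (interval M 0).indicator (fun _ => (1 : ℝ)) x) *
              walsh (2 ^ M) x := by
          rw [mul_assoc, ← indicator_walsh_apply]
          by_cases hx : x ∈ A <;> simp [hx]
        rw [funext h, integral_mul_walsh_two_pow_eq_zero]
        · simp
        · intro x y hy
          have hAy : y ∈ A ↔ x ∈ A :=
            mem_of_measurableSet_sigmaAlgebra hA (interval_subset hi x hy)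
          rw [indicator_interval_eq hy]
          congr 1
          by_cases hx : x ∈ A <;> simp [hAy, hx]
      · simp only [testMartingale, hj, hi, if_false]
        rw [condExp_of_stronglyMeasurable (dyadicFiltration.le i)
          (hsm.mono (dyadicFiltration.mono (by omega))) (integrable_indicator_walsh M)]

theorem hardyNorm_testMartingale_le {p : ℝ} (hp : 0 < p) (M : ℕ) :
    hardyNorm p (testMartingale M) ≤ (2⁻¹ ^ M) ^ (1 / p) := by
  refine ENNReal.rpow_le_rpow ?_ (by positivity)
  rw [← haar_interval M 0, ← lintegral_indicator_one (measurableSet_interval M 0)]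
  refine lintegral_mono fun x => ?_
  have hle (m : ℕ) : ‖testMartingale M m x‖ₑ ≤ (interval M 0).indicator 1 x := by
    rw [testMartingale]
    split_ifs
    · simp
    · by_cases hx : x ∈ interval M 0
      · simp [hx, Real.enorm_eq_ofReal_abs, abs_walsh]
      · simp [hx]
  refine (ENNReal.rpow_le_rpow (iSup_le hle) hp.le).trans ?_
  by_cases hx : x ∈ interval M 0 <;> simp [hx, hp]

theorem memHardy_testMartingale {p : ℝ} (hp : 0 < p) (M : ℕ) : MemHardy p (testMartingale M) := by
  refine ⟨martingale_testMartingale M, (hardyNorm_testMartingale_le hp M).trans_lt ?_⟩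
  exact ENNReal.rpow_lt_top_of_nonneg (by positivity) (by simp)

/-- The frequencies of the test martingale fill `[2 ^ M, 2 ^ (M + 1))` with equal weights, so that
its partial sums are modulated Dirichlet kernels. -/
theorem partialSum_testMartingale {M n : ℕ} (hn : n ≤ 2 ^ M) (x : WalshGroup) :
    partialSum (testMartingale M) (2 ^ M + n) x =
      2⁻¹ ^ M * (walsh (2 ^ M) x * dirichlet n x) := by
  have h2 : 2 ^ M + n ≤ 2 ^ (M + 1) := by rw [pow_succ]; omega
  rw [partialSum_eq_integral (martingale_testMartingale M) h2]
  have h (t : WalshGroup) : testMartingale M (M + 1) t * dirichlet (2 ^ M + n) (x + t) =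
      (interval M 0).indicator (fun _ => (1 : ℝ)) t * dirichlet (2 ^ M) x * walsh (2 ^ M) t +
      (interval M 0).indicator (fun _ => walsh (2 ^ M) x * dirichlet n x) t := by
    have hd := dirichlet_two_pow_mul_add hn 1 (x + t)
    rw [mul_one] at hd
    rw [testMartingale, if_neg (by omega), hd]
    by_cases ht : t ∈ interval M 0
    · rw [dirichlet_add_of_forall le_rfl x ht, dirichlet_add_of_forall hn x ht,
        walsh_add]
      have hsq : walsh (2 ^ M) t * walsh (2 ^ M) t = 1 := by
        rw [← abs_mul_abs_self, abs_walsh, one_mul]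
      simp only [Set.indicator_of_mem ht]
      linear_combination walsh (2 ^ M) x * dirichlet n x * hsq
    · simp [ht]
  have hint1 : Integrable (fun t => (interval M 0).indicator (fun _ => (1 : ℝ)) t *
      dirichlet (2 ^ M) x * walsh (2 ^ M) t) haar :=
    integrable_mul_walsh (((integrable_const _).indicator
      (measurableSet_interval M 0)).mul_const _) _
  simp only [h]
  rw [integral_add hint1 ((integrable_const _).indicator (measurableSet_interval M 0)),
    integral_mul_walsh_two_pow_eq_zero, integral_indicator_const _ (measurableSet_interval M 0),
    measureReal_def, haar_interval]
  · simp
  · intro y z hz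
    rw [indicator_interval_eq hz]

theorem abs_partialSum_testMartingale {M s u n : ℕ} (hsM : s < M) (h1 : 2 ^ M ≤ n)
    (h2 : n < 2 ^ (M + 1)) (hn : n = 2 ^ s * (2 * u + 1)) {x : WalshGroup}
    (hx : x ∈ interval (s + 1) (Pi.single s 1)) :
    |partialSum (testMartingale M) n x| = 2⁻¹ ^ M * 2 ^ s := by
  obtain ⟨d, rfl⟩ : ∃ d, M = s + 1 + d := ⟨M - (s + 1), by omega⟩
  -- Removing the leading digit of `n` keeps the lowest one.
  have hpow : 2 ^ (s + 1 + d) = 2 ^ s * (2 * 2 ^ d) := by ring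
  have hdu : 2 ^ d ≤ u := by
    rw [hn, hpow] at h1
    have := Nat.le_of_mul_le_mul_left h1 (by positivity)
    omega
  have hsplit : n = 2 ^ (s + 1 + d) + 2 ^ s * (2 * (u - 2 ^ d) + 1) := by
    rw [hn, hpow, ← mul_add]
    congr 1
    omega
  have hle : 2 ^ s * (2 * (u - 2 ^ d) + 1) ≤ 2 ^ (s + 1 + d) := by
    rw [pow_succ] at h2
    omega
  rw [hsplit, partialSum_testMartingale hle, abs_mul, abs_mul, abs_walsh, one_mul,
    abs_dirichlet_of_lowest, abs_of_pos (by positivity)]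
  · intro j hj
    rw [hx j (by omega)]
    simp [hj.ne]
  · rw [hx s (by omega)]
    simp

/-- The test martingale gives `2 ^ (s - M - 1) μ(I_{s+1}) ^ {1/p} ≤ C μ(I_M) ^ {1/p}` for every
bound `C` of the operator; this is the same inequality, solved for `C`. -/
theorem rpow_le_of_boundedFromHardy {p : ℝ} (hp : 0 < p) {n : ℕ → ℕ} {C : ℝ≥0}
    (hC : ∀ F, MemHardy p F → weakLpQuasiNorm p (maximalPartialSum n F) ≤ C * hardyNorm p F)
    {M s u k : ℕ} (hsM : s < M) (h1 : 2 ^ M ≤ n k) (h2 : n k < 2 ^ (M + 1))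
    (hn : n k = 2 ^ s * (2 * u + 1)) :
    (2 : ℝ) ^ (((M : ℝ) - s) * (1 / p - 1) - 1 - 1 / p) ≤ C := by
  -- Half of the value of `|S_n F|`, as the distribution function has a strict inequality.
  set t : ℝ≥0 := 2⁻¹ ^ M * 2 ^ s * 2⁻¹ with ht
  have ht0 : 0 < t := by positivity
  have hsub : interval (s + 1) (Pi.single s 1) ⊆
      {x | (t : ℝ≥0∞) < maximalPartialSum n (testMartingale M) x} := by
    intro x hx
    refine lt_of_lt_of_le ?_ (le_iSup (fun k => ‖partialSum (testMartingale M) (n k) x‖ₑ) k)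
    rw [Real.enorm_eq_ofReal_abs, abs_partialSum_testMartingale hsM h1 h2 hn hx,
      ← ENNReal.ofReal_coe_nnreal, ENNReal.ofReal_lt_ofReal_iff (by positivity), ht]
    push_cast
    have : (0 : ℝ) < 2⁻¹ ^ M * 2 ^ s := by positivity
    linarith
  have hmain : (t : ℝ≥0∞) * (2⁻¹ ^ (s + 1)) ^ (1 / p) ≤ C * (2⁻¹ ^ M) ^ (1 / p) := by
    calc (t : ℝ≥0∞) * (2⁻¹ ^ (s + 1)) ^ (1 / p)
        ≤ t * haar {x | (t : ℝ≥0∞) < maximalPartialSum n (testMartingale M) x} ^ (1 / p) := by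
          rw [← haar_interval (s + 1) (Pi.single s 1)]
          gcongr
      _ ≤ weakLpQuasiNorm p (maximalPartialSum n (testMartingale M)) :=
          le_weakLpQuasiNorm hp _ ht0
      _ ≤ C * hardyNorm p (testMartingale M) := hC _ (memHardy_testMartingale hp M)
      _ ≤ C * (2⁻¹ ^ M) ^ (1 / p) := by
          gcongr
          exact hardyNorm_testMartingale_le hp M
  have hreal := ENNReal.toReal_mono (ENNReal.mul_ne_top ENNReal.coe_ne_top
    (ENNReal.rpow_lt_top_of_nonneg (by positivity) (by simp)).ne) hmain
  rw [ENNReal.toReal_mul, ENNReal.toReal_mul, ← ENNReal.toReal_rpow, ← ENNReal.toReal_rpow] at hreal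
  simp only [ENNReal.coe_toReal, ENNReal.toReal_pow, ENNReal.toReal_inv, ENNReal.toReal_ofNat, ht,
    NNReal.coe_mul, NNReal.coe_pow, NNReal.coe_inv, NNReal.coe_ofNat] at hreal
  have hpw (m : ℕ) : ((2 : ℝ)⁻¹ ^ m) = 2 ^ (-(m : ℝ)) := by
    rw [Real.rpow_neg two_pos.le, Real.rpow_natCast, inv_pow]
  have hpw1 : (2 : ℝ)⁻¹ = 2 ^ (-1 : ℝ) := by
    rw [Real.rpow_neg two_pos.le, Real.rpow_one]
  rw [hpw, hpw, ← Real.rpow_natCast 2 s, hpw1, ← Real.rpow_mul two_pos.le,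
    ← Real.rpow_mul two_pos.le, ← Real.rpow_add two_pos, ← Real.rpow_add two_pos,
    ← Real.rpow_add two_pos, ← div_le_iff₀ (by positivity), ← Real.rpow_sub two_pos] at hreal
  refine le_trans (le_of_eq ?_) hreal
  congr 1
  push_cast
  ring

theorem bddAbove_of_boundedFromHardy {p : ℝ} (hp0 : 0 < p) (hp1 : p < 1) {n : ℕ → ℕ}
    (hpos : ∀ k, 0 < n k) (h : BoundedFromHardy p (weakLpQuasiNorm p) (maximalPartialSum n)) :
    BddAbove (Set.range fun k => rho (n k)) := by
  obtain ⟨C, hC⟩ := h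
  have hp : 0 < 1 / p - 1 := by
    rw [sub_pos]
    exact one_lt_one_div hp0 hp1
  obtain ⟨R, hR⟩ := exists_nat_ge ((Real.logb 2 C + 1 + 1 / p) / (1 / p - 1))
  refine ⟨R, ?_⟩
  rintro _ ⟨k, rfl⟩
  obtain ⟨s, M, u, hsM, hrho, h1, h2, hn⟩ := exists_rho_eq (hpos k)
  simp only [hrho]
  rcases hsM.eq_or_lt with rfl | hlt
  · simp
  have hle := rpow_le_of_boundedFromHardy hp0 hC hlt h1 h2 hn
  have hC0 : (0 : ℝ) < C := (Real.rpow_pos_of_pos two_pos _).trans_le hle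
  rw [← Real.le_logb_iff_rpow_le one_lt_two hC0] at hle
  have hMs : (M : ℝ) - s ≤ R := by
    refine le_trans ?_ hR
    rw [le_div_iff₀ hp]
    linarith
  rw [← Nat.cast_sub hsM] at hMs
  exact_mod_cast hMs

end WalshGroup

theorem corollary2 (p : ℝ) (hp0 : 0 < p) (hp1 : p < 1)
    (n : ℕ → ℕ) (hn : Monotone n) (hpos : ∀ k, 0 < n k) :
    (WalshGroup.BoundedFromHardy p (WalshGroup.weakLpQuasiNorm p) (WalshGroup.maximalPartialSum n) ↔
      BddAbove (Set.range fun k => WalshGroup.rho (n k))) ∧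
    (WalshGroup.BoundedFromHardy p (WalshGroup.lpQuasiNorm p) (WalshGroup.maximalPartialSum n) ↔
      BddAbove (Set.range fun k => WalshGroup.rho (n k))) :=
  ⟨⟨WalshGroup.bddAbove_of_boundedFromHardy hp0 hp1 hpos,
      fun h => (WalshGroup.boundedFromHardy_of_bddAbove hp0 hpos h).weak hp0⟩,
    ⟨fun h => WalshGroup.bddAbove_of_boundedFromHardy hp0 hp1 hpos (h.weak hp0),
      WalshGroup.boundedFromHardy_of_bddAbove hp0 hpos⟩⟩
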